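/- Let $k',k''\ge 0$ and $D\ge 0$ be integers and put $k=k'+k''$. Let $\Gamma=\{\gamma\in\mathbb Z^k\setminus\{0\}: 0\le\gamma_j\le D \text{ for } j=1,\dots,k\}$ and let $\mathcal Q:\mathbb R^k\to\mathbb R^\Gamma$ be the canonical polynomial mapping $\mathcal Q(z)=(z^\gamma)_{\gamma\in\Gamma}$, where $z^\gamma=\prod_{j=1}^k z_j^{\gamma_j}$. For an integer $q\ge 1$ let $\mathbb N_q=\{1,\dots,q\}$, $A_q=\{b\in\mathbb N_q:\gcd(b,q)=1\}$, and $$\mathbf A_q=\bigl\{a=(a_\gamma)_{\gamma\in\Gamma}\in\mathbb N_q^{\Gamma}:\ \gcd\bigl(q,(a_\gamma)_{\gamma\in\Gamma}\bigr)=1\bigr\}.$$ For $a\in\mathbf A_q$ define the mixed Gaussian sum $$G(a/q)=\frac1{q^{k'}}\cdot\frac1{\varphi(q)^{k''}}\sum_{x\in\mathbb N_q^{k'}}\ \sum_{y\in A_q^{k''}}\exp\Bigl(2\pi i\sum_{\gamma\in\Gamma}\frac{a_\gamma}{q}\,\mathcal Q_\gamma(x,y)\Bigr),$$ where $\varphi$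 is Euler's totient function. Then there are constants $C>0$ and $\delta>0$, depending only on $k'$, $k''$ and $D$, such that $$|G(a/q)|\le C\,q^{-\delta}\qquad\text{for all integers } q\ge1 \text{ and all } a\in\mathbf A_q .$$ -/

import Mathlib

namespace MixedGauss

/-- `ℕ_q = {1, …, q}`. -/
def Nq (q : ℕ) : Finset ℕ := Finset.Icc 1 q

/-- `A_q`, the elements of `{1, …, q}` that are coprime to `q`. -/
def Aq (q : ℕ) : Finset ℕ := (Nq q).filter fun a => Nat.gcd a q = 1

/-- The coordinates of `ℝ^k`, `k = k' + k''`: first the `k'` coordinates of `x`, then the `k''`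
coordinates of `y`. -/
abbrev Coord (k' k'' : ℕ) : Type := Fin k' ⊕ Fin k''

/-- `Γ`, the set of nonzero multi-indices `γ` with `0 ≤ γ_j ≤ D` for every coordinate `j`. -/
def Gam (k' k'' D : ℕ) : Finset (Coord k' k'' → ℕ) :=
  (Fintype.piFinset fun _ => Finset.Icc 0 D).filter fun γ => γ ≠ 0

/-- The canonical polynomial mapping `Q : ℝ^k → ℝ^Γ`, `Q_γ(x) = x^γ`. -/
def canonicalMap (k' k'' D : ℕ) (x : Coord k' k'' → ℝ) (γ : Gam k' k'' D) : ℝ :=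
  ∏ j, x j ^ γ.1 j

/-- The set of vectors `a ∈ ℕ_q^Γ` whose entries have no common divisor with `q` other than `1`:
`gcd (q, (a_γ)_γ) = 1`. -/
def vecAq (k' k'' D q : ℕ) : Set (Gam k' k'' D → ℕ) :=
  {a | (∀ γ, a γ ∈ Nq q) ∧ Nat.gcd q (Finset.univ.gcd a) = 1}

/-- The mixed Gaussian sum `G(a/q)`. -/
noncomputable def mixedGaussSum (k' k'' D q : ℕ) (a : Gam k' k'' D → ℕ) : ℂ :=
  1 / (q : ℂ) ^ k' * (1 / (Nat.totient q : ℂ) ^ k'') *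
    ∑ x ∈ Fintype.piFinset (fun _ : Fin k' => Nq q),
      ∑ y ∈ Fintype.piFinset (fun _ : Fin k'' => Aq q),
        Complex.exp (2 * Real.pi * Complex.I *
          ((∑ γ, (a γ : ℝ) / (q : ℝ) *
            canonicalMap k' k'' D (Sum.elim (fun i => (x i : ℝ)) (fun i => (y i : ℝ))) γ : ℝ) : ℂ))

end MixedGauss

/-! The sum is an average over `ZMod q` with product weights, uniform on the ring in the `x`
variables and on its units in the `y` variables. The Chinese remainder theorem factors it over prime
powers, with the same integer coefficients and primitive characters on each factor. For each prime
`p ∣ q` the gcd condition supplies a nonzero multi-index whose coefficient is prime to `p`.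

Modulo `p ^ n` one variable `j` with `γ j ≠ 0` is singled out. The coefficient of its power `γ j` is
a polynomial in the other variables, and by a Vandermonde argument (`card_roots_le`,
`sum_prod_weight_roots_le`) it is rarely divisible by a high power of `p`. Otherwise a one-variable
sum with a coefficient of small valuation remains (`norm_weightedSum_le_of_univariate`). For `n ≥
2`, `p`-adic stationary phase confines that sum to near-zeros of the derivative, which are again
few. For `n = 1` and `p > D`, Weyl differencing over the field applies; for `p ≤ D` the trivial
bound suffices.

The bound `C * (p ^ n) ^ (-δ)` is uniform in `p` and `n`, but multiplying it over primes would give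
one factor `C` per prime. Giving up half of `δ` absorbs `C` at every large prime, so only boundedly
many factors survive (`exists_norm_weightedSum_le`). -/

namespace MixedGauss

open Finset

/-! ### Roots of polynomials over `ℤ/p^n`. -/

section PrimePowerRing

variable {p n : ℕ}

lemma isUnit_natCast_zmod_pow [hp : Fact p.Prime] {u : ℕ} (hu : ¬ p ∣ u) :
    IsUnit (u : ZMod (p ^ n)) := by
  rw [ZMod.isUnit_iff_coprime]
  exact Nat.Coprime.pow_right _ ((Nat.Prime.coprime_iff_not_dvd hp.out).2 hu).symm

lemma prime_pow_mul_eq_zero {s : ℕ} (hs : n ≤ s) : (p : ZMod (p ^ n)) ^ s = 0 := by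
  obtain ⟨t, rfl⟩ := Nat.exists_eq_add_of_le hs
  rw [pow_add, ← Nat.cast_pow, ZMod.natCast_self, zero_mul]

lemma prime_pow_ne_zero [hp : Fact p.Prime] {s : ℕ} (hs : s < n) :
    (p : ZMod (p ^ n)) ^ s ≠ 0 := by
  rw [← Nat.cast_pow, Ne, ZMod.natCast_eq_zero_iff]
  intro h
  exact absurd ((Nat.pow_dvd_pow_iff_le_right hp.out.one_lt).1 h) (by omega)

/-- In `ℤ/p^n`, an element either divides `p^e` or is divisible by `p^(e+1)`. -/
lemma dvd_prime_pow_or_prime_pow_dvd [hp : Fact p.Prime] (x : ZMod (p ^ n)) (e : ℕ) :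
    x ∣ (p : ZMod (p ^ n)) ^ e ∨ (p : ZMod (p ^ n)) ^ (e + 1) ∣ x := by
  rcases Nat.eq_zero_or_pos x.val with h0 | h0
  · right
    rw [(ZMod.val_eq_zero x).1 h0]
    exact dvd_zero _
  obtain ⟨k, u, hu, hk⟩ := Nat.exists_eq_pow_mul_and_not_dvd h0.ne' p hp.out.ne_one
  have hx : x = (p : ZMod (p ^ n)) ^ k * (u : ZMod (p ^ n)) := by
    rw [← ZMod.natCast_zmod_val x, hk]; push_cast; rfl
  rcases le_or_gt k e with h | h
  · left
    rw [hx, (isUnit_natCast_zmod_pow hu).mul_right_dvd]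
    exact pow_dvd_pow _ h
  · right
    rw [hx]
    exact (pow_dvd_pow _ h).mul_right _

/-- A residue class modulo `p^r` has at most `p^(n-r)` elements in `ℤ/p^n`. -/
lemma card_residueClass_le [hp : Fact p.Prime] {r : ℕ} (hr : r ≤ n) (x₀ : ZMod (p ^ n))
    (T : Finset (ZMod (p ^ n))) (hT : ∀ x ∈ T, (p : ZMod (p ^ n)) ^ r ∣ x - x₀) :
    #T ≤ p ^ (n - r) := by
  classical
  have hsub : T ⊆ (range (p ^ (n - r))).image
      fun z : ℕ => x₀ + (p : ZMod (p ^ n)) ^ r * (z : ZMod (p ^ n)) := by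
    intro x hx
    obtain ⟨c, hc⟩ := hT x hx
    refine mem_image.2 ⟨c.val % p ^ (n - r), mem_range.2 (Nat.mod_lt _ (pow_pos hp.out.pos _)), ?_⟩
    have h1 : c = ((c.val % p ^ (n - r) : ℕ) : ZMod (p ^ n)) +
        (p : ZMod (p ^ n)) ^ (n - r) * ((c.val / p ^ (n - r) : ℕ) : ZMod (p ^ n)) := by
      conv_lhs => rw [← ZMod.natCast_zmod_val c, ← Nat.mod_add_div c.val (p ^ (n - r))]
      push_cast; rfl
    have h2 : (p : ZMod (p ^ n)) ^ r * (p : ZMod (p ^ n)) ^ (n - r) = 0 := by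
      rw [← pow_add]; exact prime_pow_mul_eq_zero (by omega)
    have h3 : (p : ZMod (p ^ n)) ^ r * c =
        (p : ZMod (p ^ n)) ^ r * ((c.val % p ^ (n - r) : ℕ) : ZMod (p ^ n)) := by
      conv_lhs => rw [h1, mul_add, ← mul_assoc, h2, zero_mul, add_zero]
    rw [← h3, ← hc]; ring
  calc #T ≤ _ := card_le_card hsub
    _ ≤ _ := card_image_le
    _ = _ := card_range _

/-- Multiplying by the adjugate replaces inverting the Vandermonde matrix, so zero divisors do no
harm. -/
lemma mul_det_vandermonde_mul_eq_zero {R : Type*} [CommRing R] {d : ℕ} (t : R) (v c : Fin d → R)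
    (h : ∀ i, t * ∑ j, c j * v i ^ (j : ℕ) = 0) (i : Fin d) :
    t * ((Matrix.vandermonde v).det * c i) = 0 := by
  have h1 : t • (Matrix.vandermonde v).mulVec c = 0 := by
    ext i
    simpa [Matrix.mulVec, dotProduct, Matrix.vandermonde_apply, mul_comm] using h i
  have h2 : (Matrix.vandermonde v).adjugate.mulVec (t • (Matrix.vandermonde v).mulVec c) = 0 := by
    rw [h1, Matrix.mulVec_zero]
  rw [Matrix.mulVec_smul, Matrix.mulVec_mulVec, Matrix.adjugate_mul, Matrix.smul_mulVec,
    Matrix.one_mulVec] at h2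
  simpa using congrFun h2 i

/-- A polynomial of degree at most `D` over `ℤ/p^n` with a coefficient of small valuation has few
roots modulo a power of `p`. -/
lemma card_roots_le [hp : Fact p.Prime] {D s e : ℕ} (c : Fin (D + 1) → ZMod (p ^ n))
    (i : Fin (D + 1)) (hc : (p : ZMod (p ^ n)) ^ (s + e * (D + 1) ^ 2) * c i ≠ 0)
    (T : Finset (ZMod (p ^ n)))
    (hT : ∀ x ∈ T, (p : ZMod (p ^ n)) ^ s * ∑ j, c j * x ^ (j : ℕ) = 0) :
    #T ≤ D * p ^ (n - (e + 1)) := by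
  classical
  have hen : e + 1 ≤ n := by
    by_contra hcon
    refine hc ?_
    rw [prime_pow_mul_eq_zero, zero_mul]
    have : e * 1 ≤ e * (D + 1) ^ 2 := Nat.mul_le_mul_left _ (Nat.one_le_pow _ _ (by omega))
    omega
  by_contra! hcard
  let I : Ideal (ZMod (p ^ n)) := Ideal.span {(p : ZMod (p ^ n)) ^ (e + 1)}
  have hI : ∀ x y, Ideal.Quotient.mk I x = Ideal.Quotient.mk I y ↔
      (p : ZMod (p ^ n)) ^ (e + 1) ∣ x - y := fun x y => by
    rw [Ideal.Quotient.eq, Ideal.mem_span_singleton]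
  have h1 : #T ≤ p ^ (n - (e + 1)) * #(T.image (Ideal.Quotient.mk I)) := by
    refine card_le_mul_card_image _ _ fun y hy => ?_
    obtain ⟨x₀, -, rfl⟩ := mem_image.1 hy
    exact card_residueClass_le hen x₀ _ fun x hx => (hI _ _).1 (mem_filter.1 hx).2
  have h2 : D + 1 ≤ #(T.image (Ideal.Quotient.mk I)) := by
    by_contra! h
    have : p ^ (n - (e + 1)) * #(T.image (Ideal.Quotient.mk I)) ≤ p ^ (n - (e + 1)) * D :=
      Nat.mul_le_mul_left _ (by omega)
    rw [mul_comm D] at hcard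
    omega
  -- Too many roots must occupy `D + 1` classes modulo `p ^ (e + 1)`. One root from each gives nodes
  -- whose differences divide `p ^ e`; the exponent `(D + 1) ^ 2` is a crude count of the pairs in
  -- the Vandermonde determinant.
  obtain ⟨U, hU, hUc⟩ := exists_subset_card_eq h2
  have hex : ∀ y : U, ∃ x ∈ T, Ideal.Quotient.mk I x = y := fun y => mem_image.1 (hU y.2)
  choose g hgT hg using hex
  let v : Fin (D + 1) → ZMod (p ^ n) := fun i => g ((U.equivFinOfCardEq hUc).symm i)
  have hv : ∀ i j, i ≠ j → v i - v j ∣ (p : ZMod (p ^ n)) ^ e := fun i j hij => by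
    rcases dvd_prime_pow_or_prime_pow_dvd (v i - v j) e with h | h
    · exact h
    · refine absurd ?_ hij
      have := (hI _ _).2 h
      simp only [v, hg] at this
      exact (U.equivFinOfCardEq hUc).symm.injective (Subtype.ext this)
  have hdet : (Matrix.vandermonde v).det ∣ (p : ZMod (p ^ n)) ^ (e * (D + 1) ^ 2) := by
    have h3 : ∀ i : Fin (D + 1), ∏ j ∈ Ioi i, (v j - v i) ∣
        (p : ZMod (p ^ n)) ^ (e * (D + 1)) := fun i => by
      calc ∏ j ∈ Ioi i, (v j - v i) ∣ ∏ j ∈ Ioi i, (p : ZMod (p ^ n)) ^ e :=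
            prod_dvd_prod_of_dvd _ _ fun j hj => hv j i (mem_Ioi.1 hj).ne'
        _ ∣ ∏ j, (p : ZMod (p ^ n)) ^ e := prod_dvd_prod_of_subset _ _ _ (subset_univ _)
        _ = _ := by rw [prod_const, card_univ, Fintype.card_fin, ← pow_mul]
    rw [Matrix.det_vandermonde]
    calc _ ∣ ∏ i : Fin (D + 1), (p : ZMod (p ^ n)) ^ (e * (D + 1)) :=
          prod_dvd_prod_of_dvd _ _ fun i _ => h3 i
      _ = _ := by rw [prod_const, card_univ, Fintype.card_fin, ← pow_mul]; ring_nf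
  have h4 := mul_det_vandermonde_mul_eq_zero _ v c (fun i => hT _ (hgT _)) i
  obtain ⟨z, hz⟩ := hdet
  refine hc ?_
  rw [pow_add, hz]
  calc _ = z * ((p : ZMod (p ^ n)) ^ s * ((Matrix.vandermonde v).det * c i)) := by ring
    _ = 0 := by rw [h4, mul_zero]

end PrimePowerRing

/-! ### Weyl differencing over a finite field. -/

section WeylDifferencing

open Polynomial

variable {F : Type*} [Field F] {p : ℕ} [CharP F p]

lemma natDegree_taylor_sub_self {f : F[X]} {d : ℕ} (hf : f.natDegree = d + 1) (hd : d + 1 < p)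
    {h : F} (hh : h ≠ 0) : (taylor h f - f).natDegree = d := by
  refine natDegree_eq_of_le_of_coeff_ne_zero ?_ ?_
  · rw [natDegree_le_iff_coeff_eq_zero]
    intro N hN
    rw [coeff_sub]
    rcases Nat.eq_or_lt_of_le (Nat.succ_le_of_lt hN) with h1 | h1
    · rw [← h1, Nat.succ_eq_add_one, ← hf, coeff_taylor_natDegree, coeff_natDegree, sub_self]
    · rw [coeff_eq_zero_of_natDegree_lt, coeff_eq_zero_of_natDegree_lt, sub_zero]
      · omega
      · rw [natDegree_taylor]; omega
  -- The coefficient of `X ^ d` in the difference is `(d + 1) * h` times the leading coefficient of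
  -- `f`; it is nonzero because `d + 1 < p`.
  · have h1 : (hasseDeriv d f).natDegree ≤ 1 := by
      have := natDegree_hasseDeriv_le f d
      omega
    rw [coeff_sub, taylor_coeff, eq_X_add_C_of_natDegree_le_one h1]
    simp only [eval_add, eval_mul, eval_C, eval_X, hasseDeriv_coeff, zero_add, Nat.choose_self,
      Nat.cast_one, one_mul, add_sub_cancel_right]
    rw [add_comm 1 d, Nat.choose_succ_self_right]
    refine mul_ne_zero (mul_ne_zero ?_ ?_) hh
    · rw [Ne, CharP.cast_eq_zero_iff F p]
      exact Nat.not_dvd_of_pos_of_lt (by omega) hd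
    · rw [← hf, coeff_natDegree, leadingCoeff_ne_zero]
      rintro rfl
      simp at hf

variable [Fintype F]

lemma norm_sum_addChar_sq (ψ : AddChar F ℂ) (f : F[X]) :
    ((‖∑ x, ψ (f.eval x)‖ ^ 2 : ℝ) : ℂ) = ∑ h, ∑ x, ψ ((taylor h f - f).eval x) := by
  rw [Complex.ofReal_pow, ← Complex.mul_conj', map_sum, sum_mul_sum, sum_comm]
  conv_rhs => rw [sum_comm]
  refine sum_congr rfl fun x _ => ?_
  rw [← Equiv.sum_comp (Equiv.addLeft x)]
  refine sum_congr rfl fun h _ => ?_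
  rw [← AddChar.map_neg_eq_conj, ← AddChar.map_add_eq_mul]
  simp [taylor_eval, sub_eq_add_neg, add_comm]

/-- Linear sums vanish by orthogonality. Squaring replaces `f` by the differences `f(X + h) - f(X)`,
of degree one less when `h ≠ 0`, and halves the exponent saved. -/
lemma norm_sum_addChar_le {ψ : AddChar F ℂ} (hψ : ψ.IsPrimitive) (d : ℕ) (hd : d + 1 < p)
    (f : F[X]) (hf : f.natDegree = d + 1) :
    ‖∑ x, ψ (f.eval x)‖ ≤
      2 * Fintype.card F * (Fintype.card F : ℝ) ^ (-(1 / 2 : ℝ) ^ (d + 1)) := by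
  classical
  set q : ℝ := (Fintype.card F : ℝ) with hq
  have hq1 : 1 ≤ q := by
    rw [hq]; exact_mod_cast Fintype.card_pos
  induction d generalizing f with
  | zero =>
    have h1 : ∑ x, ψ (f.eval x) = 0 := by
      have h2 := eq_X_add_C_of_natDegree_le_one hf.le
      have h3 : f.coeff 1 ≠ 0 := by
        rw [← zero_add 1, ← hf, coeff_natDegree, leadingCoeff_ne_zero]
        rintro rfl
        simp at hf
      rw [h2]
      simp only [eval_add, eval_mul, eval_C, eval_X, AddChar.map_add_eq_mul]
      rw [← sum_mul]
      have h4 := AddChar.sum_mulShift (f.coeff 1) hψ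
      rw [if_neg h3] at h4
      simp only [mul_comm (f.coeff 1)]
      rw [h4]; simp
    rw [h1, norm_zero]
    positivity
  | succ d ih =>
    have h1 : ‖∑ x, ψ (f.eval x)‖ ^ 2 ≤ q + q * (2 * q * q ^ (-(1 / 2 : ℝ) ^ (d + 1))) := by
      have h2 : ‖∑ x, ψ (f.eval x)‖ ^ 2 =
          ‖∑ h, ∑ x, ψ ((taylor h f - f).eval x)‖ := by
        rw [← norm_sum_addChar_sq, Complex.norm_real, Real.norm_of_nonneg (by positivity)]
      rw [h2, ← add_sum_erase _ _ (mem_univ (0 : F))]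
      refine (norm_add_le _ _).trans (add_le_add ?_ ?_)
      · simp [hq]
      · refine (norm_sum_le _ _).trans ?_
        refine (sum_le_card_nsmul _ _ (2 * q * q ^ (-(1 / 2 : ℝ) ^ (d + 1))) ?_).trans ?_
        · intro h hh
          exact ih (by omega) _ (natDegree_taylor_sub_self hf hd (ne_of_mem_erase hh))
        · rw [nsmul_eq_mul]
          refine mul_le_mul_of_nonneg_right ?_ (by positivity)
          rw [hq]
          exact_mod_cast card_le_univ _
    -- The diagonal term `h = 0` costs at most one more copy of the main term, so `2 + 1 ≤ 2 ^ 2`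
    -- lets the constant `2` reproduce itself.
    have h3 : q ≤ q * (q * q ^ (-(1 / 2 : ℝ) ^ (d + 1))) := by
      have h4 : 1 ≤ q * q ^ (-(1 / 2 : ℝ) ^ (d + 1)) := by
        conv_rhs => rw [← Real.rpow_one_add' (by positivity)
          (by have : (1 / 2 : ℝ) ^ (d + 1) < 1 := pow_lt_one₀ (by norm_num) (by norm_num) (by omega)
              linarith)]
        refine Real.one_le_rpow hq1 ?_
        have : (1 / 2 : ℝ) ^ (d + 1) ≤ 1 := pow_le_one₀ (by norm_num) (by norm_num)
        linarith
      nlinarith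
    have h5 : (q ^ (-(1 / 2 : ℝ) ^ (d + 1 + 1))) ^ 2 = q ^ (-(1 / 2 : ℝ) ^ (d + 1)) := by
      rw [← Real.rpow_natCast, ← Real.rpow_mul (by positivity)]
      congr 1
      rw [pow_succ (1 / 2 : ℝ) (d + 1)]; push_cast; ring
    refine le_of_sq_le_sq ?_ (by positivity)
    rw [mul_pow, h5]
    have h6 : 0 ≤ q * (q * q ^ (-(1 / 2 : ℝ) ^ (d + 1))) := by positivity
    nlinarith

end WeylDifferencing

/-! ### Polynomials in several variables and their weighted exponential sums. -/

section BoxPolynomials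

/-- The polynomial function with coefficients `a γ`, where `γ` runs over the multi-indices with
all entries at most `D`. -/
def boxPoly {ι R : Type*} [Fintype ι] [DecidableEq ι] [CommRing R] {D : ℕ}
    (a : (ι → Fin (D + 1)) → R) (x : ι → R) : R :=
  ∑ γ, a γ * ∏ j, x j ^ (γ j : ℕ)

/-- The exponential sum of a polynomial function with respect to a product of weights. -/
noncomputable def weightedSum {ι R : Type*} [Fintype ι] [DecidableEq ι] [CommRing R] [Fintype R]
    {D : ℕ} (w : ι → R → ℝ) (ψ : AddChar R ℂ) (a : (ι → Fin (D + 1)) → R) : ℂ :=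
  ∑ x : ι → R, ((∏ j, w j (x j) : ℝ) : ℂ) * ψ (boxPoly a x)

variable {R : Type*} {D k : ℕ}

lemma boxPoly_insertNth [CommRing R] (a : (Fin (k + 1) → Fin (D + 1)) → R) (j : Fin (k + 1)) (y : R)
    (x : Fin k → R) :
    boxPoly a (j.insertNth y x) =
      ∑ i, boxPoly (fun γ => a (j.insertNth i γ)) x * y ^ (i : ℕ) := by
  unfold boxPoly
  rw [← (Fin.insertNthEquiv (fun _ => Fin (D + 1)) j).sum_comp, Fintype.sum_prod_type]
  refine sum_congr rfl fun i _ => ?_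
  rw [sum_mul]
  refine sum_congr rfl fun γ _ => ?_
  rw [Fin.prod_univ_succAbove _ j]
  simp only [Fin.insertNthEquiv, Equiv.coe_fn_mk, Fin.insertNth_apply_same, Fin.insertNth_apply_succAbove]
  ring

lemma sum_prod_insertNth {S : Type*} [CommRing S] [Fintype R] (w : Fin (k + 1) → R → S)
    (j : Fin (k + 1)) (F : (Fin (k + 1) → R) → S) :
    ∑ x, (∏ i, w i (x i)) * F x =
      ∑ x : Fin k → R, (∏ i, w (j.succAbove i) (x i)) * ∑ y, w j y * F (j.insertNth y x) := by
  rw [← (Fin.insertNthEquiv (fun _ => R) j).sum_comp, Fintype.sum_prod_type, sum_comm]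
  refine sum_congr rfl fun x _ => ?_
  rw [mul_sum]
  refine sum_congr rfl fun y _ => ?_
  rw [Fin.prod_univ_succAbove _ j]
  simp only [Fin.insertNthEquiv, Equiv.coe_fn_mk, Fin.insertNth_apply_same, Fin.insertNth_apply_succAbove]
  ring

lemma sum_prod_weight {ι : Type*} [Fintype ι] [DecidableEq ι] [Fintype R] {w : ι → R → ℝ}
    (hw1 : ∀ j, ∑ y, w j y = 1) : ∑ x : ι → R, ∏ j, w j (x j) = 1 := by
  rw [← Fintype.prod_sum]
  exact prod_eq_one fun j _ => hw1 j

lemma norm_sum_mul_addChar_le [CommRing R] [Fintype R] {ι : Type*} [Fintype ι] {w : ι → ℝ} (hw0 : ∀ y, 0 ≤ w y)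
    (ψ : AddChar R ℂ) (f : ι → R) : ‖∑ y, (w y : ℂ) * ψ (f y)‖ ≤ ∑ y, w y := by
  refine (norm_sum_le _ _).trans (sum_le_sum fun y _ => ?_)
  rw [norm_mul, AddChar.norm_apply, mul_one, Complex.norm_real, Real.norm_of_nonneg (hw0 y)]

lemma norm_weightedSum_le_one [CommRing R] {ι : Type*} [Fintype ι] [DecidableEq ι] [Fintype R] {w : ι → R → ℝ}
    (hw0 : ∀ j y, 0 ≤ w j y) (hw1 : ∀ j, ∑ y, w j y = 1) (ψ : AddChar R ℂ)
    (a : (ι → Fin (D + 1)) → R) : ‖weightedSum w ψ a‖ ≤ 1 :=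
  (norm_sum_mul_addChar_le (fun _ => prod_nonneg fun j _ => hw0 j _) ψ _).trans
    (sum_prod_weight hw1).le

end BoxPolynomials

/-! ### From several variables to one, and stationary phase. -/

section PrimePowerWeights

open scoped Classical in
lemma sum_weight_roots_le {p n D s e : ℕ} [hp : Fact p.Prime] {w : ZMod (p ^ n) → ℝ}
    (hw : ∀ y, w y ≤ 2 / (p : ℝ) ^ n) (c : Fin (D + 1) → ZMod (p ^ n)) (i : Fin (D + 1))
    (hc : (p : ZMod (p ^ n)) ^ (s + e * (D + 1) ^ 2) * c i ≠ 0) :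
    ∑ y, w y * (if (p : ZMod (p ^ n)) ^ s * ∑ j, c j * y ^ (j : ℕ) = 0 then 1 else 0) ≤
      2 * D / (p : ℝ) ^ (e + 1) := by
  have hen : e + 1 ≤ n := by
    by_contra hcon
    refine hc ?_
    rw [prime_pow_mul_eq_zero, zero_mul]
    have : e * 1 ≤ e * (D + 1) ^ 2 := Nat.mul_le_mul_left _ (Nat.one_le_pow _ _ (by omega))
    omega
  have hp0 : (0 : ℝ) < p := by exact_mod_cast hp.out.pos
  simp only [mul_ite, mul_one, mul_zero]
  rw [← sum_filter]
  have h1 := card_roots_le c i hc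
    (univ.filter fun y => (p : ZMod (p ^ n)) ^ s * ∑ j, c j * y ^ (j : ℕ) = 0)
    fun x hx => (mem_filter.1 hx).2
  refine (sum_le_card_nsmul _ _ _ fun y _ => hw y).trans ?_
  rw [nsmul_eq_mul]
  calc _ ≤ ((D * p ^ (n - (e + 1)) : ℕ) : ℝ) * (2 / (p : ℝ) ^ n) :=
        mul_le_mul_of_nonneg_right (by exact_mod_cast h1) (by positivity)
    _ = _ := by
        push_cast
        obtain ⟨t, rfl⟩ := Nat.exists_eq_add_of_le hen
        rw [Nat.add_sub_cancel_left, pow_add (p : ℝ) (e + 1) t]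
        field_simp

open scoped Classical in
/-- A polynomial in several variables with a coefficient of small valuation is rarely divisible by
a large power of `p`. -/
lemma sum_prod_weight_roots_le {p n D e k : ℕ} [hp : Fact p.Prime] (s : ℕ)
    {w : Fin k → ZMod (p ^ n) → ℝ} (hw0 : ∀ j y, 0 ≤ w j y) (hw1 : ∀ j, ∑ y, w j y = 1)
    (hw : ∀ j y, w j y ≤ 2 / (p : ℝ) ^ n) (a : (Fin k → Fin (D + 1)) → ZMod (p ^ n))
    (γ : Fin k → Fin (D + 1))
    (ha : (p : ZMod (p ^ n)) ^ (s + k * (e * (D + 1) ^ 2)) * a γ ≠ 0) :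
    ∑ x, (∏ j, w j (x j)) * (if (p : ZMod (p ^ n)) ^ s * boxPoly a x = 0 then 1 else 0) ≤
      k * (2 * D / (p : ℝ) ^ (e + 1)) := by
  induction k generalizing s with
  | zero =>
    have h1 : ∀ x : Fin 0 → ZMod (p ^ n), boxPoly a x = a γ := fun x => by
      simp only [boxPoly, univ_unique, sum_singleton, univ_eq_empty, prod_empty, mul_one]
      exact congrArg a (Subsingleton.elim _ _)
    simp only [zero_mul, add_zero] at ha
    simp [h1, ha]
  | succ k ih =>
    rw [sum_prod_insertNth w 0]
    set B : ℝ := 2 * D / (p : ℝ) ^ (e + 1)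
    have hB : 0 ≤ B := by positivity
    -- Either the coefficient of `y ^ (γ 0)` is itself killed by a larger power of `p`, or few `y`
    -- are roots. Each variable thus costs `e * (D + 1) ^ 2` in the exponent and `B` in measure.
    have h1 : ∀ x : Fin k → ZMod (p ^ n),
        ∑ y, w 0 y * (if (p : ZMod (p ^ n)) ^ s * boxPoly a ((0 : Fin (k + 1)).insertNth y x) = 0
          then 1 else 0) ≤
        (if (p : ZMod (p ^ n)) ^ (s + e * (D + 1) ^ 2) *
          boxPoly (fun β => a ((0 : Fin (k + 1)).insertNth (γ 0) β)) x = 0 then 1 else 0) + B := by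
      intro x
      split_ifs with h
      · calc _ ≤ ∑ y, w 0 y := sum_le_sum fun y _ => by
              split_ifs
              · rw [mul_one]
              · rw [mul_zero]; exact hw0 _ _
          _ = 1 := hw1 0
          _ ≤ _ := by linarith
      · rw [zero_add]
        simp only [boxPoly_insertNth]
        exact sum_weight_roots_le (hw 0)
          (fun i => boxPoly (fun β => a ((0 : Fin (k + 1)).insertNth i β)) x) (γ 0) h
    calc _ ≤ ∑ x : Fin k → ZMod (p ^ n), (∏ i, w ((0 : Fin (k + 1)).succAbove i) (x i)) *
          ((if (p : ZMod (p ^ n)) ^ (s + e * (D + 1) ^ 2) *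
          boxPoly (fun β => a ((0 : Fin (k + 1)).insertNth (γ 0) β)) x = 0 then 1 else 0) + B) :=
          sum_le_sum fun x _ => mul_le_mul_of_nonneg_left (h1 x) (prod_nonneg fun j _ => hw0 _ _)
      _ ≤ k * B + 1 * B := by
          simp only [mul_add, sum_add_distrib]
          rw [← sum_mul, sum_prod_weight fun j => hw1 _]
          refine add_le_add_left (ih (s + e * (D + 1) ^ 2) (fun j => hw0 _) (fun j => hw1 _)
            (fun j => hw _) _ ((0 : Fin (k + 1)).removeNth γ) ?_) _
          rw [Fin.insertNth_self_removeNth]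
          convert ha using 3
          ring
      _ = _ := by push_cast; ring

/-- A bound for sums in one variable yields one for sums in several variables. -/
lemma norm_weightedSum_le_of_univariate {p n D k e s : ℕ} [hp : Fact p.Prime]
    {w : Fin (k + 1) → ZMod (p ^ n) → ℝ} (hw0 : ∀ j y, 0 ≤ w j y) (hw1 : ∀ j, ∑ y, w j y = 1)
    (hw : ∀ j y, w j y ≤ 2 / (p : ℝ) ^ n) (ψ : AddChar (ZMod (p ^ n)) ℂ)
    (a : (Fin (k + 1) → Fin (D + 1)) → ZMod (p ^ n)) (γ : Fin (k + 1) → Fin (D + 1))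
    (j : Fin (k + 1)) (ha : (p : ZMod (p ^ n)) ^ (s + k * (e * (D + 1) ^ 2)) * a γ ≠ 0)
    {B : ℝ} (hB0 : 0 ≤ B)
    (hB : ∀ c : Fin (D + 1) → ZMod (p ^ n), (p : ZMod (p ^ n)) ^ s * c (γ j) ≠ 0 →
      ‖∑ y, (w j y : ℂ) * ψ (∑ i, c i * y ^ (i : ℕ))‖ ≤ B) :
    ‖weightedSum w ψ a‖ ≤ k * (2 * D / (p : ℝ) ^ (e + 1)) + B := by
  classical
  unfold weightedSum
  simp only [Complex.ofReal_prod]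
  rw [sum_prod_insertNth (fun j y => (w j y : ℂ)) j]
  -- The exceptional `x`, where the hypothesis `hB` does not apply, get the trivial bound `1`; their
  -- measure is small by `sum_prod_weight_roots_le`.
  have h1 : ∀ x : Fin k → ZMod (p ^ n),
      ‖∑ y, (w j y : ℂ) * ψ (boxPoly a (j.insertNth y x))‖ ≤
      (if (p : ZMod (p ^ n)) ^ s * boxPoly (fun β => a (j.insertNth (γ j) β)) x = 0
        then 1 else 0) + B := by
    intro x
    split_ifs with h
    · have := norm_sum_mul_addChar_le (hw0 j) ψ fun y => boxPoly a (j.insertNth y x)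
      rw [hw1] at this
      linarith
    · rw [zero_add]
      simp only [boxPoly_insertNth]
      exact hB (fun i => boxPoly (fun β => a (j.insertNth i β)) x) h
  calc _ ≤ ∑ x : Fin k → ZMod (p ^ n), (∏ i, w (j.succAbove i) (x i)) *
        ((if (p : ZMod (p ^ n)) ^ s * boxPoly (fun β => a (j.insertNth (γ j) β)) x = 0
        then 1 else 0) + B) := by
        refine (norm_sum_le _ _).trans (sum_le_sum fun x _ => ?_)
        rw [norm_mul, ← Complex.ofReal_prod, Complex.norm_real,
          Real.norm_of_nonneg (prod_nonneg fun j _ => hw0 _ _)]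
        exact mul_le_mul_of_nonneg_left (h1 x) (prod_nonneg fun j _ => hw0 _ _)
    _ ≤ k * (2 * D / (p : ℝ) ^ (e + 1)) + 1 * B := by
        simp only [mul_add, sum_add_distrib]
        rw [← sum_mul, sum_prod_weight fun j => hw1 _]
        refine add_le_add_left (sum_prod_weight_roots_le s (fun j => hw0 _) (fun j => hw1 _)
            (fun j => hw _) _ (j.removeNth γ) ?_) _
        rwa [Fin.insertNth_self_removeNth]
    _ = _ := by ring

open scoped Classical in
open Polynomial in
/-- The `p`-adic stationary phase principle. -/
lemma norm_sum_le_sum_stationary {p n r : ℕ} [hp : Fact p.Prime] (hr : n ≤ 2 * r)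
    {w : ZMod (p ^ n) → ℝ} (hw0 : ∀ y, 0 ≤ w y) (hwp : ∀ y v, w (y + (p : ZMod (p ^ n)) ^ r * v) = w y)
    {ψ : AddChar (ZMod (p ^ n)) ℂ} (hψ : ψ.IsPrimitive) (f : (ZMod (p ^ n))[X]) :
    ‖∑ y, (w y : ℂ) * ψ (f.eval y)‖ ≤
      ∑ y, w y * (if (p : ZMod (p ^ n)) ^ r * f.derivative.eval y = 0 then 1 else 0) := by
  -- Translating `y` by `p ^ r * v` preserves the weight and, since `p ^ (2 * r) = 0`, changes `f`
  -- exactly by its linear Taylor term. Averaging over `v` leaves only the `y` with `p ^ r * f'(y) =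
  -- 0`.
  have h1 : ∀ v, ∑ y, (w y : ℂ) * ψ (f.eval y) =
      ∑ y, (w y : ℂ) * ψ (f.eval y) * ψ (v * ((p : ZMod (p ^ n)) ^ r * f.derivative.eval y)) := by
    intro v
    rw [← Equiv.sum_comp (Equiv.addRight ((p : ZMod (p ^ n)) ^ r * v))]
    refine sum_congr rfl fun y _ => ?_
    rw [Equiv.coe_addRight, hwp, mul_assoc, ← AddChar.map_add_eq_mul]
    obtain ⟨z, hz⟩ := f.binomExpansion y ((p : ZMod (p ^ n)) ^ r * v)
    rw [hz, mul_pow, ← pow_mul, prime_pow_mul_eq_zero (by omega : n ≤ r * 2), zero_mul, mul_zero,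
      add_zero]
    congr 3
    ring
  have h2 : (Fintype.card (ZMod (p ^ n)) : ℂ) * ∑ y, (w y : ℂ) * ψ (f.eval y) =
      (Fintype.card (ZMod (p ^ n)) : ℂ) * ∑ y, (w y : ℂ) * ψ (f.eval y) *
        (if (p : ZMod (p ^ n)) ^ r * f.derivative.eval y = 0 then 1 else 0) := by
    calc _ = ∑ v, ∑ y, (w y : ℂ) * ψ (f.eval y) *
          ψ (v * ((p : ZMod (p ^ n)) ^ r * f.derivative.eval y)) := by
          rw [← sum_congr rfl fun v _ => h1 v, sum_const, card_univ, nsmul_eq_mul]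
      _ = _ := by
          rw [sum_comm, mul_sum]
          refine sum_congr rfl fun y _ => ?_
          rw [← mul_sum, AddChar.sum_mulShift _ hψ]
          split_ifs <;> simp [mul_comm]
  rw [mul_left_cancel₀ (Nat.cast_ne_zero.2 Fintype.card_ne_zero) h2]
  refine (norm_sum_le _ _).trans (sum_le_sum fun y _ => ?_)
  rw [norm_mul, norm_mul, AddChar.norm_apply, mul_one, Complex.norm_real,
    Real.norm_of_nonneg (hw0 y)]
  split_ifs <;> simp

/-- Stationary phase followed by the root count for the derivative. Differentiation multiplies `c i`
by `i`, which costs at most the factor `p ^ v`. -/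
lemma norm_univariate_sum_le {p n r D e v : ℕ} [hp : Fact p.Prime] (hr : n ≤ 2 * r)
    {w : ZMod (p ^ n) → ℝ} (hw0 : ∀ y, 0 ≤ w y) (hw : ∀ y, w y ≤ 2 / (p : ℝ) ^ n)
    (hwp : ∀ y v, w (y + (p : ZMod (p ^ n)) ^ r * v) = w y)
    {ψ : AddChar (ZMod (p ^ n)) ℂ} (hψ : ψ.IsPrimitive) (c : Fin (D + 1) → ZMod (p ^ n))
    {i : Fin (D + 1)} (hi : i ≠ 0) (hv : ((i : ℕ) : ZMod (p ^ n)) ∣ (p : ZMod (p ^ n)) ^ v)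
    (hc : (p : ZMod (p ^ n)) ^ (r + e * (D + 1) ^ 2 + v) * c i ≠ 0) :
    ‖∑ y, (w y : ℂ) * ψ (∑ i, c i * y ^ (i : ℕ))‖ ≤ 2 * D / (p : ℝ) ^ (e + 1) := by
  classical
  have h1 := norm_sum_le_sum_stationary hr hw0 hwp hψ
    (∑ i, Polynomial.C (c i) * Polynomial.X ^ (i : ℕ))
  simp only [Polynomial.eval_finsetSum, Polynomial.eval_mul, Polynomial.eval_C,
    Polynomial.eval_pow, Polynomial.eval_X] at h1
  refine h1.trans ?_
  -- Coefficients of the derivative, padded by a zero top coefficient so that the root count applies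
  -- with the same `D`.
  let c' : Fin (D + 1) → ZMod (p ^ n) :=
    Fin.snoc (α := fun _ => ZMod (p ^ n)) (fun j : Fin D => ((j : ℕ) + 1) * c j.succ) 0
  have h2 : ∀ y, Polynomial.eval y (Polynomial.derivative
      (∑ i, Polynomial.C (c i) * Polynomial.X ^ (i : ℕ))) = ∑ j, c' j * y ^ (j : ℕ) := by
    intro y
    simp only [map_sum, Polynomial.derivative_C_mul_X_pow, Polynomial.eval_finsetSum,
      Polynomial.eval_mul, Polynomial.eval_C, Polynomial.eval_pow, Polynomial.eval_X]
    conv_lhs => rw [Fin.sum_univ_succ]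
    conv_rhs => rw [Fin.sum_univ_castSucc]
    simp only [c', Fin.snoc_castSucc, Fin.snoc_last, Fin.val_zero, Nat.cast_zero, mul_zero,
      zero_mul, zero_add, add_zero, Fin.val_succ, Nat.cast_add, Nat.cast_one, Fin.val_castSucc,
      Nat.add_sub_cancel]
    exact sum_congr rfl fun j _ => by ring
  simp only [h2]
  obtain ⟨i', rfl⟩ := Fin.exists_succ_eq.2 hi
  refine sum_weight_roots_le hw c' i'.castSucc ?_
  intro h3
  refine hc ?_
  obtain ⟨z, hz⟩ := hv
  simp only [c', Fin.snoc_castSucc] at h3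
  rw [Fin.val_succ, Nat.cast_add, Nat.cast_one] at hz
  rw [pow_add _ _ v, hz]
  linear_combination z * h3

end PrimePowerWeights

/-! ### The uniform weights on a ring and on its units. -/

section Weights

/-- The uniform probability weight on a finite ring (`b = false`) or on its units
(`b = true`). -/
noncomputable def weight (R : Type*) [CommRing R] (b : Bool) (x : R) : ℝ :=
  if b then (@ite _ (IsUnit x) (Classical.propDecidable _) (Nat.card Rˣ : ℝ)⁻¹ 0) else (Nat.card R : ℝ)⁻¹

variable {R : Type*} [CommRing R]

lemma weight_false (x : R) : weight R false x = (Nat.card R : ℝ)⁻¹ := rfl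

lemma weight_true_of_isUnit {x : R} (hx : IsUnit x) :
    weight R true x = (Nat.card Rˣ : ℝ)⁻¹ := if_pos hx

lemma weight_true_of_not_isUnit {x : R} (hx : ¬ IsUnit x) : weight R true x = 0 := if_neg hx

lemma weight_nonneg (b : Bool) (x : R) : 0 ≤ weight R b x := by
  unfold weight
  split_ifs <;> positivity

lemma sum_weight [Fintype R] (b : Bool) : ∑ x, weight R b x = 1 := by
  classical
  cases b
  · have : (Nat.card R : ℝ) ≠ 0 := Nat.cast_ne_zero.2 Nat.card_pos.ne'
    simp only [weight_false, sum_const, card_univ, nsmul_eq_mul]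
    rw [← Nat.card_eq_fintype_card, mul_inv_cancel₀ this]
  · have h : #(univ.filter fun x : R => IsUnit x) = Nat.card Rˣ := by
      rw [← Fintype.card_subtype, ← Nat.card_eq_fintype_card]
      exact (Nat.card_congr Submonoid.unitsTypeEquivIsUnitSubmonoid.toEquiv).symm
    have : (Nat.card Rˣ : ℝ) ≠ 0 := Nat.cast_ne_zero.2 Nat.card_pos.ne'
    have hw : ∀ x : R, weight R true x = if IsUnit x then (Nat.card Rˣ : ℝ)⁻¹ else 0 :=
      fun x => by
        split_ifs with hx
        · exact weight_true_of_isUnit hx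
        · exact weight_true_of_not_isUnit hx
    simp only [hw]
    rw [sum_ite, sum_const_zero, add_zero, sum_const, nsmul_eq_mul, h, mul_inv_cancel₀ this]

/-- The factor `2` comes from `φ(p ^ n) ≥ p ^ n / 2`. -/
lemma weight_zmod_prime_pow_le {p n : ℕ} [hp : Fact p.Prime] (b : Bool) (x : ZMod (p ^ n)) :
    weight (ZMod (p ^ n)) b x ≤ 2 / (p : ℝ) ^ n := by
  have hp2 : (2 : ℝ) ≤ p := by exact_mod_cast hp.out.two_le
  have hpn : 0 < (p : ℝ) ^ n := by positivity
  have hφ : (p : ℝ) ^ n ≤ 2 * (Nat.card (ZMod (p ^ n))ˣ : ℝ) := by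
    rw [Nat.card_eq_fintype_card, ZMod.card_units_eq_totient]
    rcases Nat.eq_zero_or_pos n with rfl | hn
    · simp
    · rw [Nat.totient_prime_pow hp.out hn, Nat.cast_mul, Nat.cast_pow,
        Nat.cast_sub hp.out.one_lt.le, Nat.cast_one]
      obtain ⟨n, rfl⟩ := Nat.exists_eq_succ_of_ne_zero hn.ne'
      have : 0 < (p : ℝ) ^ n := by positivity
      rw [Nat.succ_eq_add_one, Nat.add_sub_cancel, pow_succ]
      nlinarith
  unfold weight
  split_ifs
  · rw [inv_eq_one_div, div_le_div_iff₀ (by linarith) hpn]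
    linarith
  · positivity
  · rw [Nat.card_eq_fintype_card, ZMod.card, inv_eq_one_div]
    push_cast
    gcongr
    norm_num

/-- Supplies the invariance under shifts by multiples of `p ^ r` that stationary phase requires,
also for the unit weight. -/
lemma weight_add_of_isNilpotent (b : Bool) (x : R) {z : R} (hz : IsNilpotent z) :
    weight R b (x + z) = weight R b x := by
  have h : IsUnit (x + z) ↔ IsUnit x := by
    refine ⟨fun h => ?_, fun h => hz.isUnit_add_left_of_commute h (Commute.all _ _)⟩
    have := hz.neg.isUnit_add_left_of_commute h (Commute.all _ _)
    rwa [add_neg_cancel_right] at this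
  cases b
  · rfl
  · by_cases hx : IsUnit x
    · rw [weight_true_of_isUnit hx, weight_true_of_isUnit (h.2 hx)]
    · rw [weight_true_of_not_isUnit hx, weight_true_of_not_isUnit fun h' => hx (h.1 h')]

end Weights

/-! ### Bounds for a fixed prime power. -/

section PrimePowerBound

/-- If `p ^ k` is the `p`-part of `i`, then `k < p ^ k ≤ D`, and `k = 0` once `p > D`. Losing
nothing at large primes keeps the final constant independent of `p`. -/
lemma natCast_dvd_prime_pow {p n i D : ℕ} [hp : Fact p.Prime] (hi : i ≠ 0) (hiD : i ≤ D) :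
    (i : ZMod (p ^ n)) ∣ (p : ZMod (p ^ n)) ^ (if p ≤ D then D else 0) := by
  obtain ⟨k, u, hu, hk⟩ := Nat.exists_eq_pow_mul_and_not_dvd hi p hp.out.ne_one
  have hu0 : u ≠ 0 := by rintro rfl; simp at hu
  have hpk : p ^ k ≤ D := (Nat.le_mul_of_pos_right _ (Nat.pos_of_ne_zero hu0)).trans (hk ▸ hiD)
  rw [hk]
  push_cast
  rw [(isUnit_natCast_zmod_pow hu).mul_right_dvd]
  refine pow_dvd_pow _ ?_
  split_ifs with h
  · exact (Nat.lt_pow_self hp.out.one_lt).le.trans hpk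
  · by_contra! hk0
    exact h ((Nat.le_self_pow hk0.ne' p).trans hpk)

open Polynomial in
lemma norm_univariate_sum_prime_le {p D : ℕ} [hp : Fact p.Prime] (hD : D < p) (b : Bool)
    {ψ : AddChar (ZMod p) ℂ} (hψ : ψ.IsPrimitive) (c : Fin (D + 1) → ZMod p) {i : Fin (D + 1)}
    (hi : i ≠ 0) (hc : c i ≠ 0) :
    ‖∑ y, (weight (ZMod p) b y : ℂ) * ψ (∑ i, c i * y ^ (i : ℕ))‖ ≤
      6 * (p : ℝ) ^ (-(1 / 2 : ℝ) ^ D) := by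
  have hp2 : (2 : ℝ) ≤ p := by exact_mod_cast hp.out.two_le
  set Y : ℝ := (p : ℝ) ^ (-(1 / 2 : ℝ) ^ D) with hY
  have hY0 : 0 ≤ Y := by positivity
  have hpY : 1 ≤ p * Y := by
    rw [hY]
    calc (1 : ℝ) = p * (p : ℝ) ^ (-1 : ℝ) := by
          rw [Real.rpow_neg_one, mul_inv_cancel₀ (by linarith)]
      _ ≤ _ := by
          refine mul_le_mul_of_nonneg_left (Real.rpow_le_rpow_of_exponent_le (by linarith) ?_)
            (by linarith)
          exact neg_le_neg (pow_le_one₀ (by norm_num) (by norm_num))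
  set f : (ZMod p)[X] := ∑ i, C (c i) * X ^ (i : ℕ) with hf
  have hfe : ∀ y, ∑ i, c i * y ^ (i : ℕ) = f.eval y := fun y => by
    simp [hf, eval_finsetSum]
  have hdeg : f.natDegree ≤ D := natDegree_sum_le_of_forall_le _ _ fun j _ =>
    (natDegree_C_mul_X_pow_le _ _).trans (Nat.lt_succ_iff.1 j.2)
  have hcoeff : f.coeff i ≠ 0 := by
    rw [hf, finsetSum_coeff, Finset.sum_eq_single i]
    · simpa using hc
    · intro j _ hj
      rw [coeff_C_mul_X_pow, if_neg fun h => hj (Fin.ext h.symm)]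
    · simp
  have hi0 : (i : ℕ) ≠ 0 := fun h => hi (Fin.ext h)
  have hdeg1 := le_natDegree_of_ne_zero hcoeff
  obtain ⟨d, hd⟩ := Nat.exists_eq_succ_of_ne_zero (by omega : f.natDegree ≠ 0)
  have hT : ‖∑ y, ψ (f.eval y)‖ ≤ 2 * p * Y := by
    have h1 := norm_sum_addChar_le (p := p) hψ d (by omega) f hd
    rw [ZMod.card] at h1
    refine h1.trans (mul_le_mul_of_nonneg_left ?_ (by positivity))
    refine Real.rpow_le_rpow_of_exponent_le (by linarith) (neg_le_neg ?_)
    exact pow_le_pow_of_le_one (by norm_num) (by norm_num) (by omega)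
  simp only [hfe]
  cases b
  · simp only [weight_false]
    rw [← mul_sum, norm_mul, Nat.card_eq_fintype_card, ZMod.card]
    simp only [Complex.norm_real, norm_inv, RCLike.norm_natCast]
    rw [inv_mul_le_iff₀ (by linarith)]
    nlinarith
  · have h1 : ∑ y, (weight (ZMod p) true y : ℂ) * ψ (f.eval y) =
        ((p : ℂ) - 1)⁻¹ * (∑ y, ψ (f.eval y) - ψ (f.eval 0)) := by
      rw [← add_sum_erase _ _ (mem_univ (0 : ZMod p)),
        ← add_sum_erase _ (fun y => ψ (f.eval y)) (mem_univ (0 : ZMod p)), add_sub_cancel_left,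
        mul_sum]
      have h0 : weight (ZMod p) true 0 = 0 := weight_true_of_not_isUnit (by simp)
      rw [h0, Complex.ofReal_zero, zero_mul, zero_add]
      refine sum_congr rfl fun y hy => ?_
      rw [weight_true_of_isUnit (isUnit_iff_ne_zero.2 (ne_of_mem_erase hy)),
        Nat.card_eq_fintype_card, ZMod.card_units_eq_totient, Nat.totient_prime hp.out,
        Nat.cast_sub hp.out.one_lt.le]
      push_cast
      rfl
    have h2 : ‖(p : ℂ) - 1‖ = (p : ℝ) - 1 := by
      rw [← Complex.ofReal_natCast, ← Complex.ofReal_one, ← Complex.ofReal_sub,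
        Complex.norm_real, Real.norm_of_nonneg (by linarith)]
    -- Removing `y = 0` costs `1 ≤ p * Y`, and `p ≤ 2 * (p - 1)`; hence `3 * p * Y ≤ 6 * (p - 1) *
    -- Y`.
    rw [h1, norm_mul, norm_inv, h2, inv_mul_le_iff₀ (by linarith)]
    refine (norm_sub_le _ _).trans ?_
    rw [AddChar.norm_apply]
    nlinarith

lemma norm_weightedSum_prime_le {p D k : ℕ} [hp : Fact p.Prime] (hD : D < p)
    (b : Fin (k + 1) → Bool) {ψ : AddChar (ZMod (p ^ 1)) ℂ} (hψ : ψ.IsPrimitive)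
    (a : (Fin (k + 1) → Fin (D + 1)) → ZMod (p ^ 1)) {γ : Fin (k + 1) → Fin (D + 1)}
    {j : Fin (k + 1)} (hγ : γ j ≠ 0) (ha : IsUnit (a γ)) :
    ‖weightedSum (fun j => weight (ZMod (p ^ 1)) (b j)) ψ a‖ ≤
      k * (2 * D / (p : ℝ)) + 6 * (p : ℝ) ^ (-(1 / 2 : ℝ) ^ D) := by
  have h := norm_weightedSum_le_of_univariate (s := 0) (e := 0)
    (fun j y => weight_nonneg (b j) y) (fun j => sum_weight (b j))
    (fun j y => weight_zmod_prime_pow_le (b j) y) ψ a γ j (by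
      have : Fact (1 < p ^ 1) := ⟨by simpa using hp.out.one_lt⟩
      simpa using ha.ne_zero) (B := 6 * (p : ℝ) ^ (-(1 / 2 : ℝ) ^ D)) (by positivity) (by
      intro c hc
      have : Fact (p ^ 1).Prime := ⟨by simpa using hp.out⟩
      have h1 := norm_univariate_sum_prime_le (p := p ^ 1) (by simpa using hD) (b j) hψ c hγ
        (by simpa using hc)
      rw [Nat.cast_pow, pow_one (p : ℝ)] at h1
      exact h1)
  simpa using h

lemma norm_weightedSum_prime_pow_le {p n D k m e : ℕ} [hp : Fact p.Prime] (hm : 2 * m ≤ n)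
    (hn : 0 < n)
    (hme : (k + 1) * (e * (D + 1) ^ 2) + (if p ≤ D then D else 0) < m)
    (b : Fin (k + 1) → Bool) {ψ : AddChar (ZMod (p ^ n)) ℂ} (hψ : ψ.IsPrimitive)
    (a : (Fin (k + 1) → Fin (D + 1)) → ZMod (p ^ n)) {γ : Fin (k + 1) → Fin (D + 1)}
    {j : Fin (k + 1)} (hγ : γ j ≠ 0) (ha : IsUnit (a γ)) :
    ‖weightedSum (fun j => weight (ZMod (p ^ n)) (b j)) ψ a‖ ≤
      (k + 1) * (2 * D / (p : ℝ) ^ (e + 1)) := by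
  have h := norm_weightedSum_le_of_univariate
    (s := n - m + e * (D + 1) ^ 2 + (if p ≤ D then D else 0)) (e := e)
    (fun j y => weight_nonneg (b j) y) (fun j => sum_weight (b j))
    (fun j y => weight_zmod_prime_pow_le (b j) y) ψ a γ j (by
      rw [Ne, ha.mul_left_eq_zero]
      refine prime_pow_ne_zero ?_
      rw [add_mul, one_mul] at hme
      omega) (B := 2 * D / (p : ℝ) ^ (e + 1)) (by positivity) (by
      intro c hc
      -- `2 * m ≤ n` gives `n ≤ 2 * r`, as stationary phase needs, and leaves `m` powers of `p` to
      -- pay for all losses; this is the budget in `hme`.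
      refine norm_univariate_sum_le (r := n - m) (by omega) (weight_nonneg _)
        (weight_zmod_prime_pow_le _) (fun y v => weight_add_of_isNilpotent _ _ ?_) hψ c hγ
        (natCast_dvd_prime_pow (fun h => hγ (Fin.ext h)) (Nat.lt_succ_iff.1 (γ j).2)) hc
      refine ⟨n, ?_⟩
      rw [mul_pow, ← pow_mul, prime_pow_mul_eq_zero, zero_mul]
      exact Nat.le_mul_of_pos_left _ (by omega))
  refine h.trans (le_of_eq ?_)
  ring

end PrimePowerBound

/-! ### Uniformity over all prime powers. -/

section PrimePowerUniform

lemma rpow_neg_div_le_of_div_le {p : ℝ} (hp : 1 ≤ p) {m v e E : ℕ} (hE : 0 < E)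
    (h : m ≤ v + (e + 1) * E) : 1 / p ^ (e + 1) ≤ p ^ v * p ^ (-(m / E : ℝ)) := by
  have hp0 : 0 < p := by linarith
  have hE' : (1 : ℝ) ≤ E := by exact_mod_cast hE
  rw [← Real.rpow_natCast p v, ← Real.rpow_add hp0, one_div, ← Real.rpow_natCast p (e + 1),
    ← Real.rpow_neg hp0.le]
  refine Real.rpow_le_rpow_of_exponent_le hp ?_
  have h1 : (m : ℝ) ≤ v + (e + 1) * E := by exact_mod_cast h
  have h2 : (m / E : ℝ) ≤ v + (e + 1) := by
    rw [div_le_iff₀ (by linarith)]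
    have : (v : ℝ) ≤ v * E := le_mul_of_one_le_right (by positivity) hE'
    linarith
  push_cast
  linarith

/-- Exponential sums to prime power moduli have power saving, uniformly in the modulus. -/
lemma exists_norm_weightedSum_prime_pow_le (k D : ℕ) : ∃ C δ : ℝ, 1 ≤ C ∧ 0 < δ ∧
    ∀ (p n : ℕ) [Fact p.Prime], 0 < n → ∀ (b : Fin k → Bool) (ψ : AddChar (ZMod (p ^ n)) ℂ),
      ψ.IsPrimitive → ∀ a : (Fin k → Fin (D + 1)) → ℤ, (∃ γ, γ ≠ 0 ∧ ¬ (p : ℤ) ∣ a γ) →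
      ‖weightedSum (fun j => weight (ZMod (p ^ n)) (b j)) ψ fun γ => (a γ : ZMod (p ^ n))‖ ≤
        C * ((p ^ n : ℕ) : ℝ) ^ (-δ) := by
  rcases k with _ | k
  · refine ⟨1, 1, le_rfl, one_pos, fun p n _ _ b ψ _ a ⟨γ, hγ, _⟩ => ?_⟩
    exact absurd (Subsingleton.elim _ _) hγ
  -- `E` is the loss per unit of `e` over all `k + 1` variables. The `3` in `δ` comes from `n ≤ 3 *
  -- (n / 2)` for `n ≥ 2`, and `(1 / 2) ^ D` from Weyl differencing at `n = 1`.
  set E : ℕ := (k + 1) * (D + 1) ^ 2 with hE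
  have hE0 : 0 < E := by positivity
  set δ : ℝ := min (1 / (3 * E)) ((1 / 2) ^ D) with hδ
  have hδ0 : 0 < δ := lt_min (by positivity) (by positivity)
  have hδ1 : δ ≤ 1 := (min_le_right _ _).trans (pow_le_one₀ (by norm_num) (by norm_num))
  set V : ℝ := ((D : ℝ) + 1) ^ (D + 1) with hV
  have hV1 : 1 ≤ V := one_le_pow₀ (by linarith [Nat.cast_nonneg (α := ℝ) D])
  have hVD : (D : ℝ) + 1 ≤ V := le_self_pow₀ (by linarith [Nat.cast_nonneg (α := ℝ) D]) (by omega)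
  set A : ℝ := (k + 1) * (2 * D) + 6 with hA
  have hA1 : 1 ≤ A := by
    have : 0 ≤ ((k : ℝ) + 1) * (2 * D) := by positivity
    linarith
  refine ⟨A * V, δ, one_le_mul_of_one_le_of_one_le hA1 hV1, hδ0, fun p n hp hn b ψ hψ a ha => ?_⟩
  obtain ⟨γ, hγ, hpa⟩ := ha
  obtain ⟨j, hj⟩ := Function.ne_iff.1 hγ
  have hp1 : (1 : ℝ) ≤ p := by exact_mod_cast hp.out.one_lt.le
  have hp0 : (0 : ℝ) < p := by linarith
  have hunit : IsUnit ((a γ : ℤ) : ZMod (p ^ n)) := by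
    have h1 : IsCoprime (a γ) ((p : ℤ) ^ n) := IsCoprime.pow_right
      ((Nat.prime_iff_prime_int.1 hp.out).irreducible.coprime_iff_not_dvd.2 hpa).symm
    obtain ⟨u, z, huz⟩ := h1
    refine IsUnit.of_mul_eq_one (u : ZMod (p ^ n)) ?_
    have h2 := congrArg (Int.cast : ℤ → ZMod (p ^ n)) huz
    push_cast at h2
    rwa [prime_pow_mul_eq_zero le_rfl, mul_zero, add_zero, mul_comm] at h2
  have hone := norm_weightedSum_le_one (fun j y => weight_nonneg (R := ZMod (p ^ n)) (b j) y)
    (fun j => sum_weight (b j)) ψ fun γ => (a γ : ZMod (p ^ n))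
  rcases Nat.lt_or_ge 1 n with hn2 | hn1
  · set v := if p ≤ D then D else 0 with hv
    set m := n / 2 with hm
    have hpv : (p : ℝ) ^ v ≤ V := by
      rw [hv]
      split_ifs with h
      · calc (p : ℝ) ^ D ≤ ((D : ℝ) + 1) ^ D := by
              have : (p : ℝ) ≤ D := by exact_mod_cast h
              gcongr; linarith
          _ ≤ _ := pow_le_pow_right₀ (by linarith [Nat.cast_nonneg (α := ℝ) D]) (by omega)
      · simpa using hV1
    have hpm : (p : ℝ) ^ (-(m / E : ℝ)) ≤ ((p ^ n : ℕ) : ℝ) ^ (-δ) := by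
      rw [Nat.cast_pow, ← Real.rpow_natCast, ← Real.rpow_mul hp0.le]
      refine Real.rpow_le_rpow_of_exponent_le hp1 ?_
      have h3 : (n : ℝ) ≤ 3 * m := by exact_mod_cast (by omega : n ≤ 3 * m)
      have hE0' : (0 : ℝ) < E := by exact_mod_cast hE0
      have h4 : (n : ℝ) * δ ≤ m / E := by
        calc (n : ℝ) * δ ≤ (3 * m) * (1 / (3 * E)) :=
              mul_le_mul h3 (min_le_left _ _) hδ0.le (by positivity)
          _ = _ := by field_simp
      linarith
    have key : ‖weightedSum (fun j => weight (ZMod (p ^ n)) (b j)) ψ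
        fun γ => (a γ : ZMod (p ^ n))‖ ≤ A * ((p : ℝ) ^ v * (p : ℝ) ^ (-(m / E : ℝ))) := by
      rcases Nat.lt_or_ge v m with h | h
      · have hdiv := Nat.div_add_mod (m - v - 1) E
        have hmod := Nat.mod_lt (m - v - 1) hE0
        -- The largest `e` with `E * e + v < m`.
        set e := (m - v - 1) / E with he
        have h1 := norm_weightedSum_prime_pow_le (m := m) (e := e) (by omega) hn (by
          have : (k + 1) * (e * (D + 1) ^ 2) = E * e := by rw [hE]; ring
          rw [this]
          omega) b hψ (fun γ => (a γ : ZMod (p ^ n))) hj hunit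
        have h2 := rpow_neg_div_le_of_div_le hp1 hE0 (m := m) (v := v) (e := e) (by
          have : (e + 1) * E = E * e + E := by ring
          rw [this]
          omega)
        calc _ ≤ _ := h1
          _ = (k + 1) * (2 * D) * (1 / (p : ℝ) ^ (e + 1)) := by ring
          _ ≤ A * (1 / (p : ℝ) ^ (e + 1)) := by gcongr; linarith
          _ ≤ _ := by gcongr
      · refine hone.trans (one_le_mul_of_one_le_of_one_le hA1 ?_)
        rw [← Real.rpow_natCast p v, ← Real.rpow_add hp0]
        refine Real.one_le_rpow hp1 ?_
        have h3 : (m : ℝ) ≤ v := by exact_mod_cast h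
        have h4 : (m / E : ℝ) ≤ m := div_le_self (by positivity) (by exact_mod_cast hE0)
        linarith
    calc _ ≤ _ := key
      _ ≤ A * (V * ((p ^ n : ℕ) : ℝ) ^ (-δ)) := by gcongr
      _ = _ := by ring
  · obtain rfl : n = 1 := by omega
    rw [Nat.cast_pow, pow_one (p : ℝ)]
    rcases Nat.lt_or_ge D p with h | h
    · have h1 := norm_weightedSum_prime_le h b hψ (fun γ => (a γ : ZMod (p ^ 1))) hj hunit
      have h2 : (p : ℝ) ^ (-(1 / 2 : ℝ) ^ D) ≤ (p : ℝ) ^ (-δ) :=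
        Real.rpow_le_rpow_of_exponent_le hp1 (neg_le_neg (min_le_right _ _))
      have h3 : (1 : ℝ) / p ≤ (p : ℝ) ^ (-δ) := by
        rw [one_div, ← Real.rpow_neg_one]
        exact Real.rpow_le_rpow_of_exponent_le hp1 (by linarith)
      calc _ ≤ _ := h1
        _ = k * (2 * D) * (1 / (p : ℝ)) + 6 * (p : ℝ) ^ (-(1 / 2 : ℝ) ^ D) := by ring
        _ ≤ (k + 1) * (2 * D) * (p : ℝ) ^ (-δ) + 6 * (p : ℝ) ^ (-δ) := by gcongr; linarith
        _ = A * 1 * (p : ℝ) ^ (-δ) := by ring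
        _ ≤ _ := by gcongr
    · refine hone.trans ?_
      have h1 : (p : ℝ) ≤ V := by
        have : (p : ℝ) ≤ D := by exact_mod_cast h
        linarith
      calc (1 : ℝ) = 1 * p * (p : ℝ) ^ (-1 : ℝ) := by
            rw [Real.rpow_neg_one, one_mul, mul_inv_cancel₀ hp0.ne']
        _ ≤ A * V * (p : ℝ) ^ (-δ) := by
            gcongr ?_ * ?_ * ?_
            exact Real.rpow_le_rpow_of_exponent_le hp1 (by linarith)

end PrimePowerUniform

/-! ### Factorization of the sums over product rings. -/

section Multiplicativity

lemma map_boxPoly_intCast {ι R S : Type*} [Fintype ι] [DecidableEq ι] [CommRing R] [CommRing S]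
    {D : ℕ} (f : R →+* S) (a : (ι → Fin (D + 1)) → ℤ) (x : ι → R) :
    f (boxPoly (fun γ => (a γ : R)) x) = boxPoly (fun γ => (a γ : S)) fun j => f (x j) := by
  simp [boxPoly]

variable {R S : Type*} [CommRing R] [CommRing S]

lemma weight_prod (b : Bool) (x : R × S) :
    weight (R × S) b x = weight R b x.1 * weight S b x.2 := by
  cases b
  · simp only [weight_false, Nat.card_prod, Nat.cast_mul, mul_inv]
  · by_cases h1 : IsUnit x.1
    · by_cases h2 : IsUnit x.2
      · rw [weight_true_of_isUnit h1, weight_true_of_isUnit h2,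
          weight_true_of_isUnit (Prod.isUnit_iff.2 ⟨h1, h2⟩),
          Nat.card_congr MulEquiv.prodUnits.toEquiv, Nat.card_prod, Nat.cast_mul, mul_inv]
      · rw [weight_true_of_not_isUnit h2,
          weight_true_of_not_isUnit fun h => h2 (Prod.isUnit_iff.1 h).2, mul_zero]
    · rw [weight_true_of_not_isUnit h1,
        weight_true_of_not_isUnit fun h => h1 (Prod.isUnit_iff.1 h).1, zero_mul]

lemma weight_ringEquiv (e : R ≃+* S) (b : Bool) (x : R) : weight S b (e x) = weight R b x := by
  cases b
  · rw [weight_false, weight_false, Nat.card_congr e.toEquiv]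
  · by_cases h : IsUnit x
    · rw [weight_true_of_isUnit h, weight_true_of_isUnit (h.map e),
        Nat.card_congr (Units.mapEquiv e.toMulEquiv).toEquiv]
    · rw [weight_true_of_not_isUnit h, weight_true_of_not_isUnit]
      rwa [MulEquiv.isUnit_map e]

lemma isPrimitive_comp_inl {ψ : AddChar (R × S) ℂ} (hψ : ψ.IsPrimitive) :
    (ψ.compAddMonoidHom (AddMonoidHom.inl R S)).IsPrimitive := by
  intro r hr h
  refine hψ (a := (r, 0)) (by simpa [Prod.ext_iff] using hr) ?_
  ext x
  simpa [AddChar.mulShift_apply, Prod.mul_def] using DFunLike.congr_fun h x.1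

lemma isPrimitive_comp_inr {ψ : AddChar (R × S) ℂ} (hψ : ψ.IsPrimitive) :
    (ψ.compAddMonoidHom (AddMonoidHom.inr R S)).IsPrimitive := by
  intro r hr h
  refine hψ (a := (0, r)) (by simpa [Prod.ext_iff] using hr) ?_
  ext x
  simpa [AddChar.mulShift_apply, Prod.mul_def] using DFunLike.congr_fun h x.2

lemma isPrimitive_comp_ringEquiv (e : R ≃+* S) {ψ : AddChar S ℂ} (hψ : ψ.IsPrimitive) :
    (ψ.compAddMonoidHom (e : R →+ S)).IsPrimitive := by
  intro r hr h
  refine hψ (a := e r) (by simpa using hr) ?_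
  ext x
  simpa [AddChar.mulShift_apply] using DFunLike.congr_fun h (e.symm x)

variable {ι : Type*} [Fintype ι] [DecidableEq ι] [Fintype R] [Fintype S] {D : ℕ}

lemma weightedSum_ringEquiv (e : R ≃+* S) (b : ι → Bool) (ψ : AddChar S ℂ)
    (a : (ι → Fin (D + 1)) → ℤ) :
    weightedSum (fun j => weight R (b j)) (ψ.compAddMonoidHom (e : R →+ S))
      (fun γ => (a γ : R)) =
    weightedSum (fun j => weight S (b j)) ψ fun γ => (a γ : S) := by
  unfold weightedSum
  rw [← (Equiv.piCongrRight fun _ : ι => e.toEquiv).sum_comp]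
  refine sum_congr rfl fun x _ => ?_
  congr 1
  · congr 1
    exact prod_congr rfl fun j _ => (weight_ringEquiv e _ _).symm
  · exact congrArg ψ (map_boxPoly_intCast (e : R →+* S) a x)

/-- Integer coefficients reduce compatibly to both factors; all dependence on the splitting is
carried by the restricted characters. -/
lemma weightedSum_prod (b : ι → Bool) (ψ : AddChar (R × S) ℂ) (a : (ι → Fin (D + 1)) → ℤ) :
    weightedSum (fun j => weight (R × S) (b j)) ψ (fun γ => (a γ : R × S)) =
      weightedSum (fun j => weight R (b j)) (ψ.compAddMonoidHom (AddMonoidHom.inl R S))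
        (fun γ => (a γ : R)) *
      weightedSum (fun j => weight S (b j)) (ψ.compAddMonoidHom (AddMonoidHom.inr R S))
        (fun γ => (a γ : S)) := by
  unfold weightedSum
  rw [sum_mul_sum, ← Fintype.sum_prod_type', ← (Equiv.arrowProdEquivProdArrow ι _ _).sum_comp]
  refine sum_congr rfl fun x _ => ?_
  have h1 := map_boxPoly_intCast (RingHom.fst R S) a x
  have h2 := map_boxPoly_intCast (RingHom.snd R S) a x
  rw [prod_congr rfl fun j _ => weight_prod (b j) (x j), prod_mul_distrib]
  have h3 : ψ (boxPoly (fun γ => (a γ : R × S)) x) =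
      ψ (boxPoly (fun γ => (a γ : R)) (fun j => (x j).1), 0) *
      ψ (0, boxPoly (fun γ => (a γ : S)) (fun j => (x j).2)) := by
    rw [← AddChar.map_add_eq_mul]
    congr 1
    exact Prod.ext (by simpa using h1) (by simpa using h2)
  rw [h3]
  simp only [Equiv.arrowProdEquivProdArrow, Equiv.coe_fn_mk, AddChar.compAddMonoidHom_apply,
    AddMonoidHom.inl_apply, AddMonoidHom.inr_apply, Complex.ofReal_mul]
  ring

end Multiplicativity

/-! ### Arbitrary moduli. -/

section GeneralModulus

/-- Exponential sums to arbitrary moduli have power saving. -/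
lemma exists_norm_weightedSum_le (k D : ℕ) : ∃ C δ : ℝ, 0 < C ∧ 0 < δ ∧
    ∀ (q : ℕ) [NeZero q] (b : Fin k → Bool) (ψ : AddChar (ZMod q) ℂ), ψ.IsPrimitive →
      ∀ a : (Fin k → Fin (D + 1)) → ℤ,
      (∀ p : ℕ, p.Prime → p ∣ q → ∃ γ, γ ≠ 0 ∧ ¬ (p : ℤ) ∣ a γ) →
      ‖weightedSum (fun j => weight (ZMod q) (b j)) ψ fun γ => (a γ : ZMod q)‖ ≤
        C * (q : ℝ) ^ (-δ) := by
  obtain ⟨C, δ, hC, hδ, hprime⟩ := exists_norm_weightedSum_prime_pow_le k D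
  -- From `M` on, half of the saving absorbs `C`. Fewer than `M + 1` primes lie below `M`, whence
  -- the constant `C ^ M`.
  obtain ⟨M, hM⟩ := ((tendsto_rpow_atTop (half_pos hδ)).comp
    tendsto_natCast_atTop_atTop).eventually_ge_atTop C |>.exists
  have hM' : ∀ p : ℕ, M ≤ p → C ≤ (p : ℝ) ^ (δ / 2) := fun p hp =>
    hM.trans (Real.rpow_le_rpow (by positivity) (by exact_mod_cast hp) (by positivity))
  refine ⟨C ^ M, δ / 2, by positivity, by positivity, ?_⟩
  have main : ∀ (q : ℕ) [NeZero q] (b : Fin k → Bool) (ψ : AddChar (ZMod q) ℂ), ψ.IsPrimitive →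
      ∀ a : (Fin k → Fin (D + 1)) → ℤ,
      (∀ p : ℕ, p.Prime → p ∣ q → ∃ γ, γ ≠ 0 ∧ ¬ (p : ℤ) ∣ a γ) →
      ‖weightedSum (fun j => weight (ZMod q) (b j)) ψ fun γ => (a γ : ZMod q)‖ ≤
        C ^ #(q.primeFactors.filter (· < M)) * (q : ℝ) ^ (-(δ / 2)) := by
    intro q
    induction q using Nat.recOnPosPrimePosCoprime with
    | prime_pow p n hp hn =>
      intro _ b ψ hψ a ha
      have : Fact p.Prime := ⟨hp⟩
      refine (hprime p n hn b ψ hψ a (ha p hp (dvd_pow_self p hn.ne'))).trans ?_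
      have hq1 : (1 : ℝ) ≤ ((p ^ n : ℕ) : ℝ) := by exact_mod_cast Nat.one_le_pow _ _ hp.pos
      have hq0 : (0 : ℝ) < ((p ^ n : ℕ) : ℝ) := by linarith
      rw [Nat.primeFactors_prime_pow hn.ne' hp, filter_singleton]
      split_ifs with h
      · rw [card_singleton, pow_one]
        gcongr
        linarith
      · rw [card_empty, pow_zero, one_mul]
        have h1 : C ≤ ((p ^ n : ℕ) : ℝ) ^ (δ / 2) :=
          hM' _ ((not_lt.1 h).trans (Nat.le_self_pow hn.ne' p))
        calc _ ≤ ((p ^ n : ℕ) : ℝ) ^ (δ / 2) * ((p ^ n : ℕ) : ℝ) ^ (-δ) := by gcongr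
          _ = _ := by rw [← Real.rpow_add hq0]; congr 1; ring
    | zero => intro h; exact absurd rfl h.out
    | one =>
      intro _ b ψ _ a _
      simpa using norm_weightedSum_le_one (fun j y => weight_nonneg (R := ZMod 1) (b j) y)
        (fun j => sum_weight (b j)) ψ fun γ => (a γ : ZMod 1)
    | coprime m n hm hn hmn ihm ihn =>
      intro _ b ψ hψ a ha
      have : NeZero m := ⟨by omega⟩
      have : NeZero n := ⟨by omega⟩
      have e := ZMod.chineseRemainder hmn
      set ψ' := ψ.compAddMonoidHom (e.symm : ZMod m × ZMod n →+ ZMod (m * n))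
      have hψ' : ψ'.IsPrimitive := isPrimitive_comp_ringEquiv e.symm hψ
      rw [← weightedSum_ringEquiv e.symm, weightedSum_prod, norm_mul,
        hmn.primeFactors_mul, filter_union, card_union_of_disjoint
          (disjoint_filter_filter hmn.disjoint_primeFactors), pow_add, Nat.cast_mul,
        Real.mul_rpow (by positivity) (by positivity), mul_mul_mul_comm]
      refine mul_le_mul ?_ ?_ (norm_nonneg _) (by positivity)
      · exact ihm b _ (isPrimitive_comp_inl hψ') a fun p hp h => ha p hp (h.mul_right _)
      · exact ihn b _ (isPrimitive_comp_inr hψ') a fun p hp h => ha p hp (h.mul_left _)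
  intro q _ b ψ hψ a ha
  refine (main q b ψ hψ a ha).trans ?_
  gcongr
  calc _ ≤ #(range M) := card_le_card fun x hx => mem_range.2 (mem_filter.1 hx).2
    _ = M := card_range M

end GeneralModulus

/-! ### Change of index sets and representatives of residue classes. -/

section Reindexing

lemma weightedSum_reindex {ι κ R : Type*} [Fintype ι] [DecidableEq ι] [Fintype κ] [DecidableEq κ]
    [CommRing R] [Fintype R] {D : ℕ} (σ : ι ≃ κ) (w : ι → R → ℝ) (ψ : AddChar R ℂ)
    (a : (ι → Fin (D + 1)) → R) :
    weightedSum w ψ a = weightedSum (fun j => w (σ.symm j)) ψ fun γ => a fun i => γ (σ i) := by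
  unfold weightedSum
  rw [← (Equiv.arrowCongr σ.symm (Equiv.refl R)).sum_comp]
  refine sum_congr rfl fun x _ => ?_
  congr 2
  · rw [← σ.prod_comp]
    simp
  · unfold boxPoly
    rw [← (Equiv.arrowCongr σ.symm (Equiv.refl (Fin (D + 1)))).sum_comp]
    refine sum_congr rfl fun γ _ => ?_
    congr 1
    rw [← σ.prod_comp]
    simp

lemma sum_piFinset_map {α β M : Type*} [AddCommMonoid M] {k : ℕ} {f : α → β} {S : Finset α}
    {T : Finset β} (h : Set.BijOn f S T) (g : (Fin k → β) → M) :
    ∑ x ∈ Fintype.piFinset fun _ => S, g (fun i => f (x i)) =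
      ∑ y ∈ Fintype.piFinset fun _ => T, g y := by
  refine sum_bij (fun x _ i => f (x i)) ?_ ?_ ?_ fun _ _ => rfl
  · intro x hx
    exact Fintype.mem_piFinset.2 fun i => h.mapsTo (Fintype.mem_piFinset.1 hx i)
  · intro x hx y hy hxy
    exact funext fun i => h.injOn (Fintype.mem_piFinset.1 hx i) (Fintype.mem_piFinset.1 hy i)
      (congrFun hxy i)
  · intro y hy
    choose x hx hxy using fun i => h.surjOn (Fintype.mem_piFinset.1 hy i)
    exact ⟨x, Fintype.mem_piFinset.2 hx, funext hxy⟩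

variable {q : ℕ} [NeZero q]

lemma bijOn_Nq : Set.BijOn (fun x : ℕ => (x : ZMod q)) (Nq q) (univ : Finset (ZMod q)) := by
  refine ⟨fun _ _ => mem_univ _, ?_, ?_⟩
  · intro x hx y hy hxy
    simp only [Nq, coe_Icc, Set.mem_Icc] at hx hy
    have h1 := (ZMod.natCast_eq_natCast_iff x y q).1 hxy
    refine h1.eq_of_abs_lt ?_
    rw [abs_lt]
    omega
  · intro z _
    rcases eq_or_ne z 0 with rfl | hz
    -- In `{1, …, q}` the zero class is represented by `q`.
    · exact ⟨q, by simp [Nq, NeZero.one_le], by simp⟩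
    · refine ⟨z.val, ?_, by simp⟩
      simp only [Nq, coe_Icc, Set.mem_Icc]
      exact ⟨Nat.one_le_iff_ne_zero.2 ((ZMod.val_ne_zero z).2 hz), (ZMod.val_lt z).le⟩

lemma bijOn_Aq [DecidablePred fun z : ZMod q => IsUnit z] :
    Set.BijOn (fun x : ℕ => (x : ZMod q)) (Aq q) (univ.filter fun z : ZMod q => IsUnit z) := by
  have h : ∀ x : ℕ, x ∈ Aq q ↔ x ∈ Nq q ∧ IsUnit (x : ZMod q) := fun x => by
    rw [ZMod.isUnit_iff_coprime, Aq, mem_filter, Nat.Coprime]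
  refine ⟨fun x hx => ?_, fun x hx y hy => ?_, fun z hz => ?_⟩
  · exact mem_coe.2 (mem_filter.2 ⟨mem_univ _, ((h x).1 hx).2⟩)
  · exact bijOn_Nq.injOn ((h x).1 hx).1 ((h y).1 hy).1
  · obtain ⟨x, hx, rfl⟩ := bijOn_Nq.surjOn (mem_coe.2 (mem_univ z))
    exact ⟨x, (h x).2 ⟨hx, (mem_filter.1 hz).2⟩, rfl⟩

lemma sum_prod_weight_true {k : ℕ} [DecidablePred fun z : ZMod q => IsUnit z]
    (g : (Fin k → ZMod q) → ℂ) :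
    ∑ y, ((∏ i, weight (ZMod q) true (y i) : ℝ) : ℂ) * g y =
      1 / (Nat.totient q : ℂ) ^ k *
        ∑ y ∈ Fintype.piFinset fun _ => univ.filter fun z : ZMod q => IsUnit z, g y := by
  rw [mul_sum]
  symm
  refine sum_subset_zero_on_sdiff (subset_univ _) ?_ ?_
  · intro y hy
    have h1 : ∃ i, ¬ IsUnit (y i) := by
      by_contra! h
      exact (mem_sdiff.1 hy).2 (Fintype.mem_piFinset.2 fun i => mem_filter.2 ⟨mem_univ _, h i⟩)
    obtain ⟨i, hi⟩ := h1
    have h2 : ∏ i, weight (ZMod q) true (y i) = 0 :=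
      prod_eq_zero (mem_univ i) (weight_true_of_not_isUnit hi)
    rw [h2, Complex.ofReal_zero, zero_mul]
  · intro y hy
    rw [prod_congr rfl fun i _ =>
      weight_true_of_isUnit (mem_filter.1 (Fintype.mem_piFinset.1 hy i)).2]
    rw [prod_const, card_univ, Fintype.card_fin, Nat.card_eq_fintype_card,
      ZMod.card_units_eq_totient]
    push_cast
    rw [inv_pow, one_div]

end Reindexing

/-! ### The mixed Gaussian sum as a weighted sum. -/

section Comparison

variable {k' k'' D q : ℕ}

lemma mem_Gam {γ : Coord k' k'' → ℕ} : γ ∈ Gam k' k'' D ↔ (∀ j, γ j ≤ D) ∧ γ ≠ 0 := by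
  simp [Gam]

/-- The extension by zero of a coefficient vector indexed by `Γ` to all multi-indices. -/
def extendCoeff (a : Gam k' k'' D → ℕ) (β : Coord k' k'' → Fin (D + 1)) : ℤ :=
  if h : (fun j => (β j : ℕ)) ∈ Gam k' k'' D then a ⟨_, h⟩ else 0

/-- The inclusion of `Γ` into the set of all multi-indices. -/
def boxIndex (γ : Gam k' k'' D) (j : Coord k' k'') : Fin (D + 1) :=
  ⟨γ.1 j, Nat.lt_succ_of_le ((mem_Gam.1 γ.2).1 j)⟩

lemma extendCoeff_boxIndex (a : Gam k' k'' D → ℕ) (γ : Gam k' k'' D) :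
    extendCoeff a (boxIndex γ) = a γ := dif_pos γ.2

lemma boxPoly_extendCoeff {R : Type*} [CommRing R] (a : Gam k' k'' D → ℕ)
    (x : Coord k' k'' → R) :
    boxPoly (fun β => (extendCoeff a β : R)) x = ∑ γ, (a γ : R) * ∏ j, x j ^ γ.1 j := by
  symm
  refine Fintype.sum_of_injective boxIndex ?_ _ _ ?_ ?_
  · intro γ γ' h
    exact Subtype.ext (funext fun j => congrArg Fin.val (congrFun h j))
  · intro β hβ
    have : extendCoeff a β = 0 := dif_neg fun h => hβ ⟨⟨_, h⟩, rfl⟩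
    beta_reduce
    rw [this, Int.cast_zero, zero_mul]
  · intro γ
    beta_reduce
    rw [extendCoeff_boxIndex, Int.cast_natCast]
    rfl

variable [NeZero q]

lemma exp_eq_stdAddChar (a : Gam k' k'' D → ℕ) (x : Coord k' k'' → ℕ) :
    Complex.exp (2 * Real.pi * Complex.I *
      ((∑ γ, (a γ : ℝ) / (q : ℝ) * canonicalMap k' k'' D (fun j => (x j : ℝ)) γ : ℝ) : ℂ)) =
    ZMod.stdAddChar (boxPoly (fun β => (extendCoeff a β : ZMod q)) fun j => (x j : ZMod q)) := by
  have h1 : boxPoly (fun β => (extendCoeff a β : ZMod q)) (fun j => (x j : ZMod q)) =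
      ((∑ γ, (a γ : ℤ) * ∏ j, (x j : ℤ) ^ γ.1 j : ℤ) : ZMod q) := by
    rw [boxPoly_extendCoeff]
    push_cast
    rfl
  rw [h1, ZMod.stdAddChar_coe]
  congr 1
  push_cast [canonicalMap]
  rw [mul_div_assoc, sum_div]
  congr 1
  exact sum_congr rfl fun γ _ => by ring

lemma mixedGaussSum_eq_weightedSum (a : Gam k' k'' D → ℕ) :
    mixedGaussSum k' k'' D q a =
      weightedSum (fun c : Coord k' k'' => weight (ZMod q) c.isRight) ZMod.stdAddChar
        fun β => (extendCoeff a β : ZMod q) := by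
  classical
  have h1 : ∀ (x : Fin k' → ℕ) (y : Fin k'' → ℕ),
      Complex.exp (2 * Real.pi * Complex.I *
        ((∑ γ, (a γ : ℝ) / (q : ℝ) *
          canonicalMap k' k'' D (Sum.elim (fun i => (x i : ℝ)) (fun i => (y i : ℝ))) γ : ℝ) : ℂ)) =
      ZMod.stdAddChar (boxPoly (fun β => (extendCoeff a β : ZMod q))
        (Sum.elim (fun i => (x i : ZMod q)) (fun i => (y i : ZMod q)))) := fun x y => by
    have h2 := exp_eq_stdAddChar (q := q) a (Sum.elim x y)
    rw [← Sum.elim_comp_inl_inr (fun j => ((Sum.elim x y j : ℕ) : ℝ)),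
      ← Sum.elim_comp_inl_inr (fun j => ((Sum.elim x y j : ℕ) : ZMod q))] at h2
    exact h2
  unfold mixedGaussSum weightedSum
  simp only [h1]
  rw [← (Equiv.sumArrowEquivProdArrow (Fin k') (Fin k'') (ZMod q)).symm.sum_comp,
    Fintype.sum_prod_type]
  have h3 : ∀ x : Fin k' → ZMod q, ∑ y ∈ Fintype.piFinset fun _ : Fin k'' => Aq q,
      ZMod.stdAddChar (boxPoly (fun β => (extendCoeff a β : ZMod q))
        (Sum.elim x (fun i => (y i : ZMod q)))) = _ := fun x =>
    sum_piFinset_map (bijOn_Aq (q := q)) fun y => ZMod.stdAddChar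
      (boxPoly (fun β => (extendCoeff a β : ZMod q)) (Sum.elim x y))
  simp only [h3]
  rw [sum_piFinset_map (bijOn_Nq (q := q)) (fun x => ∑ y ∈ Fintype.piFinset fun _ : Fin k'' =>
      univ.filter fun z : ZMod q => IsUnit z, ZMod.stdAddChar
      (boxPoly (fun β => (extendCoeff a β : ZMod q)) (Sum.elim x y))), Fintype.piFinset_univ,
    mul_sum]
  refine sum_congr rfl fun x _ => ?_
  rw [mul_assoc, ← sum_prod_weight_true, mul_sum]
  refine sum_congr rfl fun y _ => ?_
  rw [Fintype.prod_sum_type, Complex.ofReal_mul, mul_assoc]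
  congr 1
  simp [Equiv.sumArrowEquivProdArrow, weight_false, Nat.card_eq_fintype_card]

omit [NeZero q] in
-- Otherwise `p` would divide `q` and every `a γ`, hence their gcd `1`. The index found may depend
-- on `p`, which the general bound allows.
lemma exists_not_dvd_extendCoeff {a : Gam k' k'' D → ℕ} (ha : a ∈ vecAq k' k'' D q) {p : ℕ}
    (hp : p.Prime) (hpq : p ∣ q) : ∃ β, β ≠ 0 ∧ ¬ (p : ℤ) ∣ extendCoeff a β := by
  by_contra! h
  refine hp.one_lt.ne' (Nat.dvd_one.1 ?_)
  rw [← ha.2]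
  refine Nat.dvd_gcd hpq (Finset.dvd_gcd fun γ _ => ?_)
  have h1 := h (boxIndex γ) fun h0 => (mem_Gam.1 γ.2).2
    (funext fun j => congrArg Fin.val (congrFun h0 j))
  rw [extendCoeff_boxIndex] at h1
  exact_mod_cast h1

end Comparison

end MixedGauss

theorem mainTheorem10 (k' k'' D : ℕ) :
    ∃ C : ℝ, 0 < C ∧ ∃ δ : ℝ, 0 < δ ∧
      ∀ q : ℕ, 1 ≤ q → ∀ a ∈ MixedGauss.vecAq k' k'' D q,
        ‖MixedGauss.mixedGaussSum k' k'' D q a‖ ≤ C * (q : ℝ) ^ (-δ) := by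
  obtain ⟨C, δ, hC, hδ, h⟩ := MixedGauss.exists_norm_weightedSum_le (k' + k'') D
  refine ⟨C, hC, δ, hδ, fun q hq a ha => ?_⟩
  have : NeZero q := ⟨by omega⟩
  rw [MixedGauss.mixedGaussSum_eq_weightedSum, MixedGauss.weightedSum_reindex finSumFinEquiv]
  refine h q _ _ (ZMod.isPrimitive_stdAddChar q)
    (fun γ => MixedGauss.extendCoeff a fun i => γ (finSumFinEquiv i)) fun p hp hpq => ?_
  obtain ⟨β, hβ, hpβ⟩ := MixedGauss.exists_not_dvd_extendCoeff ha hp hpq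
  refine ⟨fun i => β (finSumFinEquiv.symm i), fun h0 => hβ (funext fun j => ?_), ?_⟩
  · simpa using congrFun h0 (finSumFinEquiv j)
  · simpa using hpβ
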